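/- **Setting.** Let $K\ge 2$, $S\ge 0$ and $N=K^S$ be integers (so $S=\log_K N$), and let $\bar\phi_u=2\pi u/N$, $u=0,\dots,N-1$, be the angular grid. A base station (BS) with $N_{BS}$ antennas and a mobile station (MS) with $N_{MS}$ antennas have arbitrary array responses $a_{BS}(\phi)\in\mathbb C^{N_{BS}}$, $a_{MS}(\theta)\in\mathbb C^{N_{MS}}$. The single-path channel is $$H=\sqrt{N_{BS}N_{MS}/\rho}\;\alpha\,a_{MS}(\theta)\,a_{BS}(\phi)^H,\qquad \rho>0,\quad \alpha\sim\mathcal{CN}(0,\bar P_R),$$ with angle of departure (AoD) $\phi=\bar\phi_u$ and angle of arrival (AoA) $\theta=\bar\phi_v$ on the grid; $d=(u,v)$ is called the direction. **Codebooks.** At each stage $s=1,\dots,S$ and for each $k=1,\dots,K^{s-1}$, the BS has a matrix $F_{(s,k)}$ and the MS a matrix $W_{(s,k)}$, each with $K$ unit-norm columns (beams). Beam $m$ of subset $k$ is assigned the set of grid indices $$I_{(s,k,m)}=\Big\{u:\ \tfrac{N}{K^s}(K(k-1)+m-1)\le u<\tfrac N{K^s}(K(k-1)+m)\Big\}.$$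 $G_{(s,k)}$ is the $N\times K$ zero-one matrix whose column $m$ is the indicator of $I_{(s,k,m)}$. With $A_{BS,D}$, $A_{MS,D}$ the matrices whose columns are the array responses at the grid points, and constants $C^{BS}_s,C^{MS}_s\ge 0$, let $E^{BS}_{(s,k)}=A_{BS,D}^HF_{(s,k)}-C_s^{BS}G_{(s,k)}$ and $E^{MS}_{(s,k)}=A_{MS,D}^HW_{(s,k)}-C_s^{MS}G_{(s,k)}$. For a pair $(k_B,k_M)$ of subsets let $\mathbf G=G_{(s,k_B)}^T\otimes G_{(s,k_M)}^T$ and $$\mathbf E=(E^{BS}_{(s,k_B)})^T\otimes (E^{MS}_{(s,k_M)})^T+(E^{BS}_{(s,k_B)})^T\otimes C^{MS}_sG_{(s,k_M)}^T+C^{BS}_sG_{(s,k_B)}^T\otimes (E^{MS}_{(s,k_M)})^T .$$ Rows of $\mathbf G,\mathbf E$ are beam pairs and columns are directions. If $\mathbf G_{m,d}=1$, the forward gain is $G^F_{(s,k_B,k_M,d)}=\big|\sqrt{G_{(s)}}+\sqrt{N_{BS}N_{MS}}\,\mathbf E_{m,d}\big|^2$ with $G_{(s)}=N_{BS}(C_s^{BS})^2N_{MS}(C_s^{MS})^2$.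 If $\mathbf G_{\bar m,d}=0$, the backward gain is $G^B_{(s,k_B,k_M,d,\bar m)}=N_{BS}N_{MS}|\mathbf E_{\bar m,d}|^2$. Let $\beta_{(s,k_B,k_M,d,\bar m)}=G^F_{(s,k_B,k_M,d)}/G^B_{(s,k_B,k_M,d,\bar m)}\in[0,\infty]$, with value $0$ if $G^F=0$ and $\infty$ if only $G^B=0$. **Algorithm.** Start with $k_1^{BS}=k_1^{MS}=1$. At stage $s=1,\dots,S$, with training power $P_s\ge 0$, the MS obtains for every beam pair $(m_B,m_M)$ the measurement $$y_{m_B,m_M}=\sqrt{P_s}\,w^HHf+w^H n_{s,m_B,m_M},\qquad f=[F_{(s,k_s^{BS})}]_{:,m_B},\quad w=[W_{(s,k_s^{MS})}]_{:,m_M}.$$ It selects a pair $(m_B^\star,m_M^\star)$ of maximal $|y_{m_B,m_M}|^2$ (ties resolved arbitrarily) and sets $k^{BS}_{s+1}=K(k_s^{BS}-1)+m_B^\star$, $k^{MS}_{s+1}=K(k_s^{MS}-1)+m_M^\star$. After stage $S$ the estimates are $\hat\phi=\bar\phi_{k^{BS}_{S+1}-1}$, $\hat\theta=\bar\phi_{k^{MS}_{S+1}-1}$.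 The entries of all noise vectors $n_{s,m_B,m_M}\in\mathbb C^{N_{MS}}$ are i.i.d. circularly symmetric complex Gaussian, centred, and independent of $\alpha$. Their mean power is either $\sigma^2$ (total variance $\sigma^2$) or $2\sigma^2$ (variance $\sigma^2$ per real dimension), where $\sigma>0$; the claim holds in both conventions. Let $\bar\gamma=\bar P_R/(\rho\sigma^2)$. **Theorem.** For every true direction $d=(u,v)$, the error probability $\bar p=\Pr\big((\hat\phi,\hat\theta)\ne(\phi,\theta)\big)$, averaged over the path gain and the noise, satisfies $$\bar p\ \le\ \frac{K^2-1}{2}\sum_{s=1}^{S}\left(1-\frac{\left(1-\frac1{\beta_s}\right)P_sG^F_s\bar\gamma}{4\sqrt{1+\frac12\left(1+\frac1{\beta_s}\right)P_sG^F_s\bar\gamma+\frac1{16}P_s^2(G^F_s)^2\bar\gamma^2\left(1-\frac1{\beta_s}\right)^2}}\right)$$ in each of the following two cases: 1. $\beta_s$ is the minimum of $\beta_{(s,k_B,k_M,d',\bar m)}$ over all $k_B,k_M\in\{1,\dots,K^{s-1}\}$, all directions $d'$ in the ranges of these subsets, and all beam pairs $\bar m$ with $\mathbf G_{\bar m,d'}=0$;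 and $G^F_s$ is the minimum of the forward gains $G^F_{(s,k_B,k_M,d')}$ over the same $k_B,k_M,d'$. 2. The same minima are taken over the true direction $d'=d$ only; that is, $G^F_s$ is the forward gain in direction $d$ at stage $s$, and $\beta_s$ is the smallest ratio of this forward gain to a backward gain in direction $d$. If $G^F_s=0$, the $s$-th summand is read as $1$. -/

import Mathlib

open MeasureTheory ProbabilityTheory
open scoped ENNReal NNReal Kronecker Matrix

noncomputable section

namespace MmWave

/-- The circularly symmetric complex Gaussian law `CN(0, v)`: independent centred real and
imaginary parts of variance `v / 2` each, so that the mean of `|z|²` is `v`. -/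
def complexGaussian (v : ℝ≥0) : Measure ℂ :=
  ((gaussianReal 0 (v / 2)).prod (gaussianReal 0 (v / 2))).map
    (fun p : ℝ × ℝ => (p.1 : ℂ) + (p.2 : ℂ) * Complex.I)

/-- The `u`-th point `2πu/N` of the uniform angular grid. -/
def gridAngle (N : ℕ) (u : ℕ) : ℝ := 2 * Real.pi * u / N

/-- A hierarchical codebook for an array of `n` antennas. Stages, subsets and beams are counted
from `0`: level `s` has the subsets `k < K ^ s` (the values at other `k` are never used), and the
columns of `mat s k` are the `K` unit-norm beamforming vectors of subset `k`. `C s` is the nominal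
projection of a beam on the array responses inside its sub-range. -/
structure Codebook (n K S : ℕ) where
  mat : Fin S → ℕ → Matrix (Fin n) (Fin K) ℂ
  C : Fin S → ℝ
  C_nonneg : ∀ s, 0 ≤ C s
  unit_norm : ∀ (s : Fin S) (k : ℕ) (m : Fin K), k < K ^ (s : ℕ) →
    ∑ i, ‖mat s k i m‖ ^ 2 = 1

/-- The grid point `u` lies in the sub-range of beam `m` of subset `k` at level `s`. -/
def InSubrange (N K s k m u : ℕ) : Prop :=
  N / K ^ (s + 1) * (K * k + m) ≤ u ∧ u < N / K ^ (s + 1) * (K * k + m + 1)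

open Classical in
/-- The `N × K` zero-one matrix of the ideal beam patterns. -/
def patternMatrix (N K s k : ℕ) : Matrix (Fin N) (Fin K) ℂ :=
  Matrix.of fun u m => if InSubrange N K s k m u then 1 else 0

/-- The dictionary whose columns are the array responses at the grid angles. -/
def dictionary {n : ℕ} (N : ℕ) (a : ℝ → Fin n → ℂ) : Matrix (Fin n) (Fin N) ℂ :=
  Matrix.of fun i u => a (gridAngle N u) i

/-- The error matrix `A_Dᴴ F_(s,k) - C_s G_(s,k)` of one codebook. -/
def errorMatrix {n K S : ℕ} (N : ℕ) (a : ℝ → Fin n → ℂ) (F : Codebook n K S)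
    (s : Fin S) (k : ℕ) : Matrix (Fin N) (Fin K) ℂ :=
  (dictionary N a)ᴴ * F.mat s k - (F.C s : ℂ) • patternMatrix N K s k

/-- A precoder/combiner pair `(m_BS, m_MS)`. -/
abbrev BeamPair (K : ℕ) := Fin K × Fin K

/-- A quantized direction: grid indices of the AoD and of the AoA. -/
abbrev Direction (N : ℕ) := Fin N × Fin N

/-- The joint `K² × N²` pattern matrix of the subsets `kB`, `kM` at level `s`. -/
def jointPattern (N K s kB kM : ℕ) : Matrix (BeamPair K) (Direction N) ℂ :=
  (patternMatrix N K s kB)ᵀ ⊗ₖ (patternMatrix N K s kM)ᵀ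

section System

variable {nB nM K S : ℕ}

/-- The joint `K² × N²` error matrix of the subsets `kB`, `kM` at level `s`. -/
def jointError (N : ℕ) (aB : ℝ → Fin nB → ℂ) (aM : ℝ → Fin nM → ℂ)
    (F : Codebook nB K S) (W : Codebook nM K S) (s : Fin S) (kB kM : ℕ) :
    Matrix (BeamPair K) (Direction N) ℂ :=
  (errorMatrix N aB F s kB)ᵀ ⊗ₖ (errorMatrix N aM W s kM)ᵀ
    + (errorMatrix N aB F s kB)ᵀ ⊗ₖ ((W.C s : ℂ) • (patternMatrix N K s kM)ᵀ)
    + ((F.C s : ℂ) • (patternMatrix N K s kB)ᵀ) ⊗ₖ (errorMatrix N aM W s kM)ᵀ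

/-- The nominal training beamforming gain `G_(s) = (N_BS C_BS²) (N_MS C_MS²)`. -/
def nominalGain (F : Codebook nB K S) (W : Codebook nM K S) (s : Fin S) : ℝ :=
  ((nB : ℝ) * F.C s ^ 2) * ((nM : ℝ) * W.C s ^ 2)

/-- The forward gain in direction `d`; used for the pair `m` whose main lobe contains `d`. -/
def forwardGain (N : ℕ) (aB : ℝ → Fin nB → ℂ) (aM : ℝ → Fin nM → ℂ)
    (F : Codebook nB K S) (W : Codebook nM K S) (s : Fin S) (kB kM : ℕ)
    (m : BeamPair K) (d : Direction N) : ℝ :=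
  ‖(Real.sqrt (nominalGain F W s) : ℂ)
    + (Real.sqrt ((nB : ℝ) * nM) : ℂ) * jointError N aB aM F W s kB kM m d‖ ^ 2

/-- The backward gain in direction `d`; used for pairs `m` whose main lobe does not contain `d`. -/
def backwardGain (N : ℕ) (aB : ℝ → Fin nB → ℂ) (aM : ℝ → Fin nM → ℂ)
    (F : Codebook nB K S) (W : Codebook nM K S) (s : Fin S) (kB kM : ℕ)
    (m : BeamPair K) (d : Direction N) : ℝ :=
  (nB : ℝ) * nM * ‖jointError N aB aM F W s kB kM m d‖ ^ 2

/-- The smallest forward-to-backward ratio at stage `s` over all subsets, all directions `d ∈ D`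
and all pairs `m'` whose main lobe misses `d`, where `m` is the pair whose main lobe contains `d`.
The ratio is `∞` if only the backward gain vanishes, and `0` if the forward gain vanishes. -/
def worstRatio (N : ℕ) (aB : ℝ → Fin nB → ℂ) (aM : ℝ → Fin nM → ℂ)
    (F : Codebook nB K S) (W : Codebook nM K S) (D : Set (Direction N)) (s : Fin S) : ℝ≥0∞ :=
  sInf {r | ∃ kB < K ^ (s : ℕ), ∃ kM < K ^ (s : ℕ), ∃ d ∈ D, ∃ m m' : BeamPair K,
    jointPattern N K s kB kM m d = 1 ∧ jointPattern N K s kB kM m' d = 0 ∧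
    r = ENNReal.ofReal (forwardGain N aB aM F W s kB kM m d) /
      ENNReal.ofReal (backwardGain N aB aM F W s kB kM m' d)}

/-- The smallest forward gain at stage `s` over all subsets and all directions `d ∈ D`. -/
def worstForwardGain (N : ℕ) (aB : ℝ → Fin nB → ℂ) (aM : ℝ → Fin nM → ℂ)
    (F : Codebook nB K S) (W : Codebook nM K S) (D : Set (Direction N)) (s : Fin S) : ℝ :=
  sInf {g | ∃ kB < K ^ (s : ℕ), ∃ kM < K ^ (s : ℕ), ∃ d ∈ D, ∃ m : BeamPair K,
    jointPattern N K s kB kM m d = 1 ∧ g = forwardGain N aB aM F W s kB kM m d}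

/-- The single-path channel `√(N_BS N_MS / ρ) α a_MS(θ) a_BS(φ)ᴴ`. -/
def channel (aB : ℝ → Fin nB → ℂ) (aM : ℝ → Fin nM → ℂ) (ρ : ℝ) (α : ℂ) (φ θ : ℝ) :
    Matrix (Fin nM) (Fin nB) ℂ :=
  ((Real.sqrt ((nB : ℝ) * nM / ρ) : ℂ) * α) • Matrix.vecMulVec (aM θ) (star (aB φ))

/-- The indices of the scalar noise samples: stage, precoder, combiner, receive antenna. A fresh
noise vector corrupts each precoder/combiner measurement. -/
abbrev NoiseIndex (S K nM : ℕ) := Fin S × Fin K × Fin K × Fin nM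

/-- The received signals of stage `s` when the subsets `kB` and `kM` are in use:
`y = √P_s wᴴ H f + wᴴ n` for each precoder/combiner pair. -/
def received (F : Codebook nB K S) (W : Codebook nM K S) (P : Fin S → ℝ)
    (H : Matrix (Fin nM) (Fin nB) ℂ) (noise : NoiseIndex S K nM → ℂ)
    (s : Fin S) (kB kM : ℕ) (m : BeamPair K) : ℂ :=
  (Real.sqrt (P s) : ℂ) * ((W.mat s kM)ᴴ * H * F.mat s kB) m.2 m.1
    + ∑ i, star (W.mat s kM i m.2) * noise (s, m.1, m.2, i)

/-- A rule that picks a pair of maximal received power; ties are resolved in any way. -/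
def IsArgmaxRule (sel : (BeamPair K → ℂ) → BeamPair K) : Prop :=
  ∀ (Y : BeamPair K → ℂ) (m : BeamPair K), ‖Y m‖ ^ 2 ≤ ‖Y (sel Y)‖ ^ 2

/-- The adaptive search: the pair of subset indices in use before each stage and, at
`Fin.last S`, the pair of grid indices that is the outcome. It starts from subset `0` on both
sides; beam `m` of subset `k` leads to subset `K k + m` of the next level. -/
def search (sel : (BeamPair K → ℂ) → BeamPair K) (F : Codebook nB K S) (W : Codebook nM K S)
    (P : Fin S → ℝ) (H : Matrix (Fin nM) (Fin nB) ℂ) (noise : NoiseIndex S K nM → ℂ) :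
    Fin (S + 1) → ℕ × ℕ :=
  Fin.induction (motive := fun _ => ℕ × ℕ) (0, 0) fun s k =>
    let m := sel (received F W P H noise s k.1 k.2)
    (K * k.1 + m.1, K * k.2 + m.2)

/-- The estimated AoD and AoA. -/
def estimate (N : ℕ) (sel : (BeamPair K → ℂ) → BeamPair K) (F : Codebook nB K S)
    (W : Codebook nM K S) (P : Fin S → ℝ) (H : Matrix (Fin nM) (Fin nB) ℂ)
    (noise : NoiseIndex S K nM → ℂ) : ℝ × ℝ :=
  (gridAngle N (search sel F W P H noise (Fin.last S)).1,
    gridAngle N (search sel F W P H noise (Fin.last S)).2)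

end System

/-- The summand of the bound, with `x = P_s G^F_s γ̄`. If `β = ∞`, then `1/β = 0`. (If `β = 0`, a
forward gain vanishes; the worst forward gain and hence `x` are then `0`, and the summand is `1`.) -/
def stageTerm (β : ℝ≥0∞) (x : ℝ) : ℝ :=
  1 - (1 - (β⁻¹).toReal) * x /
    (4 * Real.sqrt (1 + 1 / 2 * (1 + (β⁻¹).toReal) * x
      + 1 / 16 * x ^ 2 * (1 - (β⁻¹).toReal) ^ 2))

/-- `((K² - 1) / 2) ∑ₛ stageTerm β_s (P_s G^F_s γ̄)`. -/
def errorBound {S : ℕ} (K : ℕ) (P : Fin S → ℝ) (γ : ℝ) (β : Fin S → ℝ≥0∞) (GF : Fin S → ℝ) : ℝ :=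
  ((K : ℝ) ^ 2 - 1) / 2 * ∑ s, stageTerm (β s) (P s * GF s * γ)

end MmWave

end

open MeasureTheory ProbabilityTheory
open scoped ENNReal NNReal Kronecker Matrix

noncomputable section

namespace MmWave

/-! ### The circularly symmetric complex Gaussian law -/

/-! The search errs only if, at some stage on the true path of subsets, a wrong beam pair is at
least as strong as the right one. These comparison events use the fixed true subsets, whatever the
search has actually done, so a union bound over stages and the `K ^ 2 - 1` wrong pairs needs no
conditioning on earlier decisions (`search_eq_pathIndex`, `errorProbability_le`).

Each comparison involves two jointly circular Gaussians: the common path gain with different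
amplitudes, plus independent noises. A linear change of variables makes the pair independent while
preserving the sign of `|X|² - |Y|²`. The squared moduli are then independent exponentials, whose
comparison probability is `B / (A + B)`; this gives an exact pairwise error
(`measure_norm_le_norm_of_jointly_gaussian`, `measure_received_le`).

In the normalised powers `x`, `y` of the right and wrong pair, that error grows with leakage and
noise and falls with signal strength. Half the stage summand is exactly its value at noise power
`2σ²`, worst forward gain and worst ratio, so it dominates every case and both noise conventions
(`pairwise_le_stageTerm`). Stages where this comparison would fail have summand at least `1`, and
the whole bound is then trivial. -/

instance isProbabilityMeasure_complexGaussian (v : ℝ≥0) :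
    IsProbabilityMeasure (complexGaussian v) :=
  Measure.isProbabilityMeasure_map (by fun_prop)

lemma charFun_complexGaussian (v : ℝ≥0) (t : ℂ) :
    charFun (complexGaussian v) t = Complex.exp (-(v * ‖t‖ ^ 2 / 4 : ℝ)) := by
  have hr : ∀ x : ℝ, ∫ y, Complex.exp (x * y * Complex.I) ∂gaussianReal 0 (v / 2)
      = Complex.exp (-(v * x ^ 2 / 4 : ℝ)) := by
    intro x
    rw [← charFun_apply_real, charFun_gaussianReal]
    congr 1
    push_cast
    ring
  rw [charFun_apply, complexGaussian, integral_map (by fun_prop) (by fun_prop)]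
  have : ∀ p : ℝ × ℝ, Complex.exp ((inner ℝ ((p.1 : ℂ) + p.2 * Complex.I) t : ℝ) * Complex.I)
      = Complex.exp (t.re * p.1 * Complex.I) * Complex.exp (t.im * p.2 * Complex.I) := by
    intro p
    rw [← Complex.exp_add, Complex.inner]
    congr 1
    simp
    ring
  simp_rw [this]
  rw [integral_prod_mul (fun x : ℝ => Complex.exp (t.re * x * Complex.I))
    (fun y : ℝ => Complex.exp (t.im * y * Complex.I)), hr, hr, ← Complex.exp_add]
  congr 1
  rw [← Complex.normSq_eq_norm_sq, Complex.normSq_apply]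
  push_cast
  ring

/-- Polar coordinates: the planar density depends only on the radius, so the angle contributes a
factor `2π` and the modulus is Rayleigh distributed. -/
lemma lintegral_complexGaussian_radial {v : ℝ≥0} (hv : v ≠ 0) {g : ℝ → ℝ≥0∞}
    (hg : Measurable g) :
    ∫⁻ z, g ‖z‖ ∂complexGaussian v =
      ∫⁻ r in Set.Ioi (0 : ℝ), ENNReal.ofReal (2 * r / v * Real.exp (-(r ^ 2 / v))) * g r := by
  have hv2 : v / 2 ≠ 0 := by positivity
  have hv0 : (0 : ℝ) < v := by positivity
  have hpi := Real.pi_pos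
  rw [complexGaussian, lintegral_map (by fun_prop) (by fun_prop),
    gaussianReal_of_var_ne_zero 0 hv2,
    prod_withDensity (measurable_gaussianPDF _ _) (measurable_gaussianPDF _ _),
    lintegral_withDensity_eq_lintegral_mul _ (by fun_prop) (by fun_prop), ← Measure.volume_eq_prod,
    ← lintegral_comp_polarCoord_symm]
  have key : ∀ p ∈ polarCoord.target, ENNReal.ofReal p.1 •
      (((fun z : ℝ × ℝ => gaussianPDF 0 (v / 2) z.1 * gaussianPDF 0 (v / 2) z.2) *
        fun a : ℝ × ℝ => g ‖(a.1 : ℂ) + a.2 * Complex.I‖) (polarCoord.symm p)) =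
      ENNReal.ofReal (p.1 / (Real.pi * v) * Real.exp (-(p.1 ^ 2 / v))) * g p.1 := by
    rintro ⟨r, t⟩ hp
    have hr : 0 < r := by simpa using hp.1
    have hn : ‖((r * Real.cos t : ℝ) : ℂ) + (r * Real.sin t : ℝ) * Complex.I‖ = r := by
      have := Complex.norm_polarCoord_symm (r, t)
      rw [Complex.polarCoord_symm_apply, abs_of_pos hr] at this
      refine Eq.trans ?_ this
      congr 1
      push_cast
      ring
    simp only [polarCoord_symm_apply, Pi.mul_apply, hn, gaussianPDF, smul_eq_mul]
    rw [← mul_assoc, ← ENNReal.ofReal_mul (gaussianPDFReal_nonneg _ _ _),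
      ← ENNReal.ofReal_mul hr.le]
    congr 2
    simp only [gaussianPDFReal]
    have h1 : (2 * Real.pi * ((v / 2 : ℝ≥0) : ℝ)) = Real.pi * v := by push_cast; ring
    rw [h1]
    have h2 : ∀ A B : ℝ, r * ((Real.sqrt (Real.pi * v))⁻¹ * Real.exp A
        * ((Real.sqrt (Real.pi * v))⁻¹ * Real.exp B))
        = r / (Real.pi * v) * Real.exp (A + B) := by
      intro A B
      have h3 : (Real.sqrt (Real.pi * v))⁻¹ * (Real.sqrt (Real.pi * v))⁻¹ = (Real.pi * v)⁻¹ := by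
        rw [← mul_inv, Real.mul_self_sqrt (by positivity)]
      rw [Real.exp_add, div_eq_mul_inv, ← h3]
      ring
    rw [h2]
    congr 2
    push_cast
    have := Real.sin_sq_add_cos_sq t
    field_simp
    linear_combination (-r ^ 2) * this
  rw [setLIntegral_congr_fun polarCoord.open_target.measurableSet key, polarCoord_target,
    Measure.volume_eq_prod, ← Measure.prod_restrict, lintegral_prod _ (by fun_prop)]
  refine setLIntegral_congr_fun measurableSet_Ioi fun r hr => ?_
  have hr : (0 : ℝ) < r := hr
  simp only [lintegral_const, Measure.restrict_apply_univ, Real.volume_Ioo]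
  rw [mul_right_comm, ← ENNReal.ofReal_mul (by positivity)]
  congr 2
  field_simp
  ring

lemma lintegral_Ioi_rayleigh {c : ℝ} (hc : 0 < c) {R : ℝ} (hR : 0 ≤ R) :
    ∫⁻ r in Set.Ioi R, ENNReal.ofReal (2 * c * r * Real.exp (-(c * r ^ 2))) =
      ENNReal.ofReal (Real.exp (-(c * R ^ 2))) := by
  have hd : ∀ x ∈ Set.Ici R, HasDerivAt (fun r : ℝ => -Real.exp (-(c * r ^ 2)))
      (2 * c * x * Real.exp (-(c * x ^ 2))) x := by
    intro x _
    have := (((hasDerivAt_pow 2 x).const_mul c).neg.exp).neg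
    refine this.congr_deriv ?_
    simp only [Pi.neg_apply, Nat.cast_ofNat, Nat.add_one_sub_one, pow_one]
    ring
  have hpos : ∀ x ∈ Set.Ioi R, 0 ≤ 2 * c * x * Real.exp (-(c * x ^ 2)) := by
    intro x hx
    have : 0 < x := lt_of_le_of_lt hR hx
    positivity
  have hlim : Filter.Tendsto (fun r : ℝ => -Real.exp (-(c * r ^ 2))) Filter.atTop (nhds 0) := by
    rw [← neg_zero]
    refine (Real.tendsto_exp_neg_atTop_nhds_zero.comp ?_).neg
    exact (Filter.tendsto_pow_atTop two_ne_zero).const_mul_atTop hc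
  rw [← ofReal_integral_eq_lintegral_ofReal
    (integrableOn_Ioi_deriv_of_nonneg' hd hpos hlim)
    ((ae_restrict_iff' measurableSet_Ioi).2 (ae_of_all _ hpos)),
    integral_Ioi_of_hasDerivAt_of_nonneg' hd hpos hlim]
  simp

lemma complexGaussian_norm_ge {v : ℝ≥0} (hv : v ≠ 0) {R : ℝ} (hR : 0 ≤ R) :
    complexGaussian v {w | R ≤ ‖w‖} = ENNReal.ofReal (Real.exp (-(R ^ 2 / v))) := by
  have hv0 : (0 : ℝ) < v := by positivity
  have hm : Measurable ((Set.Ici R).indicator (1 : ℝ → ℝ≥0∞)) :=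
    measurable_one.indicator measurableSet_Ici
  have h1 : complexGaussian v {w | R ≤ ‖w‖}
      = ∫⁻ z, (Set.Ici R).indicator (1 : ℝ → ℝ≥0∞) ‖z‖ ∂complexGaussian v := by
    rw [← lintegral_indicator_one (measurableSet_le measurable_const measurable_norm)]
    rfl
  rw [h1, lintegral_complexGaussian_radial hv hm]
  have h2 : ∀ r : ℝ, ENNReal.ofReal (2 * r / v * Real.exp (-(r ^ 2 / v)))
      * (Set.Ici R).indicator (1 : ℝ → ℝ≥0∞) r = (Set.Ici R).indicator
        (fun r => ENNReal.ofReal (2 * (1 / v) * r * Real.exp (-(1 / v * r ^ 2)))) r := by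
    intro r
    by_cases hr : r ∈ Set.Ici R
    · simp only [Set.indicator_of_mem hr, Pi.one_apply, mul_one]
      congr 2
      · ring
      · congr 1; ring
    · simp [Set.indicator_of_notMem hr]
  simp_rw [h2]
  rw [lintegral_indicator measurableSet_Ici, Measure.restrict_restrict measurableSet_Ici,
    setLIntegral_congr (t := Set.Ioi R), lintegral_Ioi_rayleigh (by positivity) hR]
  · congr 3; ring
  · have : Set.Ioi R = Set.Ioi R ∩ Set.Ioi 0 :=
      (Set.inter_eq_left.2 (Set.Ioi_subset_Ioi hR)).symm
    rw [this]
    exact Ioi_ae_eq_Ici.symm.inter (ae_eq_refl _)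

/-- The Laplace transform of the exponential variable `|z|²`: the extra factor turns the Rayleigh
density into a multiple of the one with parameter `1 / v + t`. -/
lemma lintegral_exp_neg_complexGaussian {v : ℝ≥0} (hv : v ≠ 0) {t : ℝ} (ht : 0 ≤ t) :
    ∫⁻ z, ENNReal.ofReal (Real.exp (-(t * ‖z‖ ^ 2))) ∂complexGaussian v =
      ENNReal.ofReal (1 / (1 + t * v)) := by
  have hv0 : (0 : ℝ) < v := by positivity
  rw [lintegral_complexGaussian_radial hv
    (g := fun r => ENNReal.ofReal (Real.exp (-(t * r ^ 2)))) (by fun_prop)]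
  have h2 : ∀ r ∈ Set.Ioi (0 : ℝ), ENNReal.ofReal (2 * r / v * Real.exp (-(r ^ 2 / v)))
      * ENNReal.ofReal (Real.exp (-(t * r ^ 2))) = ENNReal.ofReal (1 / (1 + t * v)) *
        ENNReal.ofReal (2 * (1 / v + t) * r * Real.exp (-((1 / v + t) * r ^ 2))) := by
    intro r hr
    have hr : 0 < r := hr
    rw [← ENNReal.ofReal_mul (by positivity), ← ENNReal.ofReal_mul (by positivity)]
    congr 1
    have : -((1 / v + t) * r ^ 2) = -(r ^ 2 / v) + -(t * r ^ 2) := by ring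
    rw [this, Real.exp_add]
    field_simp
  rw [setLIntegral_congr_fun measurableSet_Ioi h2, lintegral_const_mul _ (by fun_prop),
    lintegral_Ioi_rayleigh (by positivity) le_rfl]
  simp

/-- Competing exponentials: for fixed first modulus the tail of the second is `exp (-|z|² / B)`,
whose mean is the Laplace transform at `1 / B`. -/
lemma complexGaussian_prod_norm_le {A B : ℝ≥0} (hA : A ≠ 0) (hB : B ≠ 0) :
    ((complexGaussian A).prod (complexGaussian B)) {p | ‖p.1‖ ≤ ‖p.2‖} =
      ENNReal.ofReal (B / (A + B)) := by
  have hA0 : (0 : ℝ) < A := by positivity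
  have hB0 : (0 : ℝ) < B := by positivity
  rw [Measure.prod_apply (measurableSet_le (by fun_prop) (by fun_prop))]
  have : ∀ z : ℂ, complexGaussian B (Prod.mk z ⁻¹' {p : ℂ × ℂ | ‖p.1‖ ≤ ‖p.2‖})
      = ENNReal.ofReal (Real.exp (-(1 / B * ‖z‖ ^ 2))) := by
    intro z
    refine (complexGaussian_norm_ge hB (norm_nonneg z)).trans ?_
    congr 3
    ring
  simp_rw [this]
  rw [lintegral_exp_neg_complexGaussian hA (by positivity)]
  congr 1
  field_simp
  ring

/-! ### Linear combinations of independent complex Gaussians -/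

lemma complexGaussian_map_const_mul (v : ℝ≥0) (c : ℂ) :
    (complexGaussian v).map (fun z => c * z) = complexGaussian (v * ‖c‖₊ ^ 2) := by
  have : IsProbabilityMeasure ((complexGaussian v).map (fun z => c * z)) :=
    Measure.isProbabilityMeasure_map (by fun_prop)
  refine Measure.ext_of_charFun (funext fun t => ?_)
  have h : charFun ((complexGaussian v).map (fun z => c * z)) t
      = charFun (complexGaussian v) (star c * t) := by
    rw [charFun_apply, charFun_apply, integral_map (by fun_prop) (by fun_prop)]
    congr 1 with z
    congr 3
    simp only [Complex.inner, map_mul, RCLike.star_def]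
    congr 1
    ring
  rw [h, charFun_complexGaussian, charFun_complexGaussian]
  congr 2
  simp only [norm_mul, norm_star, NNReal.coe_mul, NNReal.coe_pow, coe_nnnorm]
  ring_nf

section Probability

variable {Ω : Type*} [MeasurableSpace Ω] {μ : Measure Ω}

lemma hasLaw_const_mul {X : Ω → ℂ} {v : ℝ≥0} (hX : HasLaw X (complexGaussian v) μ) (c : ℂ) :
    HasLaw (fun ω => c * X ω) (complexGaussian (v * ‖c‖₊ ^ 2)) μ := by
  have hc : HasLaw (fun z : ℂ => c * z) (complexGaussian (v * ‖c‖₊ ^ 2)) (complexGaussian v) :=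
    ⟨by fun_prop, complexGaussian_map_const_mul v c⟩
  exact hc.fun_comp hX

/-- Characteristic functions multiply under independence. Unlike densities, they also cover zero
variances, such as a vanishing mean path power. -/
lemma hasLaw_linear_combination [IsProbabilityMeasure μ] {ι : Type*} [Fintype ι]
    {X : Ω → ℂ} {Z : ι → Ω → ℂ} {p v : ℝ≥0}
    (hX : HasLaw X (complexGaussian p) μ) (hZ : ∀ i, HasLaw (Z i) (complexGaussian v) μ)
    (hind : iIndepFun Z μ) (hXZ : IndepFun X (fun ω i => Z i ω) μ) (a : ℂ) (c : ι → ℂ) :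
    HasLaw (fun ω => a * X ω + ∑ i, c i * Z i ω)
      (complexGaussian (p * ‖a‖₊ ^ 2 + v * ∑ i, ‖c i‖₊ ^ 2)) μ := by
  have haX := hasLaw_const_mul hX a
  have hcZ : ∀ i, HasLaw (fun ω => c i * Z i ω) (complexGaussian (v * ‖c i‖₊ ^ 2)) μ :=
    fun i => hasLaw_const_mul (hZ i) (c i)
  have hZm : ∀ i, AEMeasurable (Z i) μ := fun i => (hZ i).aemeasurable
  have hsum : AEMeasurable (fun ω => ∑ i, c i * Z i ω) μ :=
    Finset.aemeasurable_fun_sum _ fun i _ => (hcZ i).aemeasurable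
  have hm : AEMeasurable (fun ω => a * X ω + ∑ i, c i * Z i ω) μ := haX.aemeasurable.add hsum
  refine ⟨hm, ?_⟩
  have : IsProbabilityMeasure (μ.map (fun ω => a * X ω + ∑ i, c i * Z i ω)) :=
    Measure.isProbabilityMeasure_map hm
  refine Measure.ext_of_charFun ?_
  have hi1 : IndepFun (fun ω => a * X ω) (fun ω => ∑ i, c i * Z i ω) μ :=
    hXZ.comp (φ := fun x => a * x) (ψ := fun z : ι → ℂ => ∑ i, c i * z i)
      (by fun_prop) (by fun_prop)
  have hi2 : iIndepFun (fun i ω => c i * Z i ω) μ :=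
    hind.comp (fun i z => c i * z) (fun i => by fun_prop)
  rw [hi1.charFun_map_fun_add_eq_mul haX.aemeasurable hsum,
    hi2.charFun_map_fun_sum_eq_prod (fun i => (hcZ i).aemeasurable), haX.map_eq]
  simp_rw [(hcZ _).map_eq]
  ext t
  simp only [Pi.mul_apply, Finset.prod_apply, charFun_complexGaussian]
  rw [← Complex.exp_sum, ← Complex.exp_add]
  congr 1
  push_cast
  rw [Finset.mul_sum, add_mul, Finset.sum_mul, add_div, Finset.sum_div, neg_add,
    Finset.sum_neg_distrib]

lemma integral_cexp_re {X : Ω → ℂ} {v : ℝ≥0} (hX : HasLaw X (complexGaussian v) μ) :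
    ∫ ω, Complex.exp ((X ω).re * Complex.I) ∂μ = Complex.exp (-(v / 4 : ℝ)) := by
  have h := charFun_complexGaussian v 1
  rw [← hX.map_eq, charFun_apply, integral_map hX.aemeasurable (by fun_prop)] at h
  simpa [Complex.inner] using h

/-- Every real functional on `ℂ × ℂ` is the real part of a complex linear form, so these integrals
determine the joint law. -/
lemma map_prodMk_eq_prod_complexGaussian [IsProbabilityMeasure μ] {X Y : Ω → ℂ} {A B : ℝ≥0}
    (hX : AEMeasurable X μ) (hY : AEMeasurable Y μ)
    (h : ∀ s t : ℂ, ∫ ω, Complex.exp ((s * X ω + t * Y ω).re * Complex.I) ∂μ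
      = Complex.exp (-((A * ‖s‖ ^ 2 + B * ‖t‖ ^ 2) / 4 : ℝ))) :
    μ.map (fun ω => (X ω, Y ω)) = (complexGaussian A).prod (complexGaussian B) := by
  have : IsProbabilityMeasure (μ.map (fun ω => (X ω, Y ω))) :=
    Measure.isProbabilityMeasure_map (by fun_prop)
  refine charFun_eq_prod_iff.1 fun t => ?_
  rw [charFun_apply, integral_map (by fun_prop) (by fun_prop),
    integral_map (by fun_prop) (by fun_prop), charFun_complexGaussian, charFun_complexGaussian,
    ← Complex.exp_add]
  have hst := h (star t.fst) (star t.snd)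
  simp only [norm_star] at hst
  convert hst using 1
  · congr 1 with ω
    congr 3
    simp [WithLp.prod_inner_apply, Complex.inner]
  · congr 1
    change -((A * ‖t.fst‖ ^ 2 / 4 : ℝ) : ℂ) + -((B * ‖t.snd‖ ^ 2 / 4 : ℝ) : ℂ) = _
    push_cast
    ring

/-- The probability that the first of two jointly circular complex Gaussians, of variances `a` and
`b` and correlation `c`, has the smaller modulus. The map `(x, y) ↦ (x + q y, q̄ x + y)` multiplies
the form `|x|² - |y|²` by `1 - |q|²` and, for a suitable `q`, makes the two independent. -/
lemma measure_norm_le_norm_of_jointly_gaussian [IsProbabilityMeasure μ] {X Y : Ω → ℂ}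
    {a b : ℝ} {c : ℂ}
    (ha : 0 < a) (hb : 0 < b) (hc : ‖c‖ ^ 2 < a * b)
    (hX : AEMeasurable X μ) (hY : AEMeasurable Y μ)
    (h : ∀ s t : ℂ, ∫ ω, Complex.exp ((s * X ω + t * Y ω).re * Complex.I) ∂μ
      = Complex.exp (-((a * ‖s‖ ^ 2 + b * ‖t‖ ^ 2 + 2 * (s * star t * c).re) / 4 : ℝ))) :
    μ.real {ω | ‖X ω‖ ≤ ‖Y ω‖} =
      (1 - (a - b) / Real.sqrt ((a + b) ^ 2 - 4 * ‖c‖ ^ 2)) / 2 := by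
  set D := Real.sqrt ((a + b) ^ 2 - 4 * ‖c‖ ^ 2) with hD
  have hpos : (a - b) ^ 2 < (a + b) ^ 2 - 4 * ‖c‖ ^ 2 := by nlinarith
  have hD2 : D ^ 2 = (a + b) ^ 2 - 4 * ‖c‖ ^ 2 :=
    Real.sq_sqrt (by nlinarith [sq_nonneg (a - b)])
  have hDab : |a - b| < D := by
    rw [hD]
    exact Real.lt_sqrt_of_sq_lt (by rwa [sq_abs])
  have hD0 : 0 < D := (abs_nonneg _).trans_lt hDab
  obtain ⟨hDl, hDr⟩ := abs_lt.1 hDab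
  -- With `q = -κ c`, the new correlation `c + q (a + b) + q² c̄` vanishes iff `c = 0` or `|c|² κ² -
  -- (a + b) κ + 1 = 0`. This is the smaller root, in a form that survives `c = 0`; it yields `1 -
  -- |q|² = κ D > 0`.
  set κ := 2 / (a + b + D) with hκdef
  have hκ0 : 0 < κ := by positivity
  have hκm : κ * (a + b + D) = 2 := by rw [hκdef]; field_simp
  have hκ : κ ^ 2 * ‖c‖ ^ 2 = κ * (a + b) - 1 := by
    have h4 : 4 * ‖c‖ ^ 2 = (a + b + D) * (a + b - D) := by linear_combination hD2
    have : 4 * (κ ^ 2 * ‖c‖ ^ 2) = 4 * (κ * (a + b) - 1) := by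
      linear_combination κ ^ 2 * h4 + (κ * (a + b - D) - 2) * hκm
    linarith
  -- `A` and `B` are the variances of the decorrelated pair, factored so that their positivity
  -- follows from `|a - b| < D`.
  set A := κ * D * (D + (a - b)) / 2 with hA
  set B := κ * D * (D - (a - b)) / 2 with hB
  have hA0 : 0 < A := by
    have : 0 < D + (a - b) := by linarith
    positivity
  have hB0 : 0 < B := by
    have : 0 < D - (a - b) := by linarith
    positivity
  have hA' : A = a - 2 * κ * ‖c‖ ^ 2 + κ ^ 2 * ‖c‖ ^ 2 * b := by
    rw [hκ, hA]
    linear_combination (κ / 2) * hD2 + (a - b) / 2 * hκm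
  have hB' : B = b - 2 * κ * ‖c‖ ^ 2 + κ ^ 2 * ‖c‖ ^ 2 * a := by
    rw [hκ, hB]
    linear_combination (κ / 2) * hD2 + (b - a) / 2 * hκm
  set q : ℂ := -(κ * c) with hq
  have hq1 : 0 < 1 - ‖q‖ ^ 2 := by
    have : ‖q‖ ^ 2 = κ ^ 2 * ‖c‖ ^ 2 := by
      rw [hq, norm_neg, norm_mul, Complex.norm_real, mul_pow, Real.norm_eq_abs, sq_abs]
    rw [this, hκ]
    have : 0 < κ * D := by positivity
    linarith
  have hnsq : ‖c‖ ^ 2 = c.re ^ 2 + c.im ^ 2 := by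
    rw [← Complex.normSq_eq_norm_sq, Complex.normSq_apply]; ring
  have hlaw := map_prodMk_eq_prod_complexGaussian (μ := μ)
    (X := fun ω => X ω + q * Y ω) (Y := fun ω => star q * X ω + Y ω)
    (A := A.toNNReal) (B := B.toNNReal) (by fun_prop) (by fun_prop) (by
      intro s t
      have h1 := h (s + t * star q) (s * q + t)
      convert h1 using 1
      · congr 1 with ω
        congr 3
        ring_nf
      · congr 3
        rw [Real.coe_toNNReal _ hA0.le, Real.coe_toNNReal _ hB0.le, hA', hB', hq]
        simp only [← Complex.normSq_eq_norm_sq, Complex.normSq_apply]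
        rw [hnsq] at hκ
        simp
        linear_combination (-2 * ((s.re * t.re + s.im * t.im) * c.re
          - (s.im * t.re - s.re * t.im) * c.im)) * hκ)
  have hset : {ω | ‖X ω‖ ≤ ‖Y ω‖} =
      (fun ω => (X ω + q * Y ω, star q * X ω + Y ω)) ⁻¹' {p : ℂ × ℂ | ‖p.1‖ ≤ ‖p.2‖} := by
    ext ω
    have hid : ‖X ω + q * Y ω‖ ^ 2 - ‖star q * X ω + Y ω‖ ^ 2
        = (1 - ‖q‖ ^ 2) * (‖X ω‖ ^ 2 - ‖Y ω‖ ^ 2) := by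
      simp only [← Complex.normSq_eq_norm_sq, Complex.normSq_apply]
      simp
      ring
    simp only [Set.mem_ofPred_eq, Set.mem_preimage]
    rw [← sq_le_sq₀ (norm_nonneg _) (norm_nonneg _), ← sq_le_sq₀ (norm_nonneg _) (norm_nonneg _),
      ← sub_nonpos, ← sub_nonpos (b := ‖star q * X ω + Y ω‖ ^ 2), hid]
    constructor
    · intro hle
      exact mul_nonpos_of_nonneg_of_nonpos hq1.le hle
    · intro hle
      exact nonpos_of_mul_nonpos_right hle hq1
  rw [Measure.real, hset, ← Measure.map_apply_of_aemeasurable (by fun_prop)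
    (measurableSet_le (by fun_prop) (by fun_prop)), hlaw,
    complexGaussian_prod_norm_le (Real.toNNReal_pos.2 hA0).ne' (Real.toNNReal_pos.2 hB0).ne',
    Real.coe_toNNReal _ hA0.le, Real.coe_toNNReal _ hB0.le, ENNReal.toReal_ofReal (by positivity)]
  have hAB : A + B = κ * D ^ 2 := by rw [hA, hB]; ring
  rw [hAB, hB]
  field_simp

end Probability

/-- Two observations of the same Gaussian signal through unit-norm combinations of disjoint noise
samples: the probability that the first is not the stronger one. -/
lemma measure_norm_le_norm_of_observations {Ω : Type*} [MeasurableSpace Ω] {μ : Measure Ω}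
    [IsProbabilityMeasure μ] {ι : Type*} [Fintype ι]
    {X : Ω → ℂ} {Z : ι → Ω → ℂ} {p v : ℝ≥0} (hv : v ≠ 0)
    (hX : HasLaw X (complexGaussian p) μ) (hZ : ∀ i, HasLaw (Z i) (complexGaussian v) μ)
    (hind : iIndepFun Z μ) (hXZ : IndepFun X (fun ω i => Z i ω) μ) (a₁ a₂ : ℂ) (c₁ c₂ : ι → ℂ)
    (h₁ : ∑ i, ‖c₁ i‖ ^ 2 = 1) (h₂ : ∑ i, ‖c₂ i‖ ^ 2 = 1) (h₁₂ : ∀ i, c₁ i = 0 ∨ c₂ i = 0) :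
    μ.real {ω | ‖a₁ * X ω + ∑ i, c₁ i * Z i ω‖ ≤ ‖a₂ * X ω + ∑ i, c₂ i * Z i ω‖} =
      (1 - (p * ‖a₁‖ ^ 2 - p * ‖a₂‖ ^ 2) / Real.sqrt ((p * ‖a₁‖ ^ 2 - p * ‖a₂‖ ^ 2) ^ 2
        + 4 * v * (p * ‖a₁‖ ^ 2 + p * ‖a₂‖ ^ 2) + 4 * v ^ 2)) / 2 := by
  have hv0 : (0 : ℝ) < v := by positivity
  -- Disjoint noise contributes nothing to the correlation, which comes from the common signal
  -- alone.
  have hc : ‖(p : ℂ) * (a₁ * star a₂)‖ ^ 2 = (p * ‖a₁‖ ^ 2) * (p * ‖a₂‖ ^ 2) := by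
    rw [norm_mul, norm_mul, norm_star]
    simp
    ring
  have hlt : ‖(p : ℂ) * (a₁ * star a₂)‖ ^ 2 < (p * ‖a₁‖ ^ 2 + v) * (p * ‖a₂‖ ^ 2 + v) := by
    rw [hc]
    have h3 : 0 ≤ (p : ℝ) * ‖a₁‖ ^ 2 := by positivity
    have h4 : 0 ≤ (p : ℝ) * ‖a₂‖ ^ 2 := by positivity
    nlinarith
  rw [measure_norm_le_norm_of_jointly_gaussian (a := p * ‖a₁‖ ^ 2 + v) (b := p * ‖a₂‖ ^ 2 + v)
    (by positivity) (by positivity) hlt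
    (hasLaw_linear_combination hX hZ hind hXZ a₁ c₁).aemeasurable
    (hasLaw_linear_combination hX hZ hind hXZ a₂ c₂).aemeasurable, hc]
  · congr 3
    · ring
    · congr 1
      ring
  · intro s t
    have hlaw := integral_cexp_re (hasLaw_linear_combination hX hZ hind hXZ (s * a₁ + t * a₂)
      (fun i => s * c₁ i + t * c₂ i))
    convert hlaw using 1
    · congr 1 with ω
      congr 3
      simp only [add_mul, Finset.sum_add_distrib, mul_add, mul_assoc, Finset.mul_sum]
      ring_nf
    · have hsum : ∑ i, ‖s * c₁ i + t * c₂ i‖ ^ 2 = ‖s‖ ^ 2 + ‖t‖ ^ 2 := by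
        have : ∀ i, ‖s * c₁ i + t * c₂ i‖ ^ 2
            = ‖s‖ ^ 2 * ‖c₁ i‖ ^ 2 + ‖t‖ ^ 2 * ‖c₂ i‖ ^ 2 := by
          intro i
          rcases h₁₂ i with h | h <;> simp [h, mul_pow]
        simp_rw [this]
        rw [Finset.sum_add_distrib, ← Finset.mul_sum, ← Finset.mul_sum, h₁, h₂, mul_one, mul_one]
      congr 3
      simp only [NNReal.coe_add, NNReal.coe_mul, NNReal.coe_pow, coe_nnnorm, NNReal.coe_sum, hsum]
      simp only [← Complex.normSq_eq_norm_sq, Complex.normSq_apply]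
      simp
      ring

/-! ### Gains of beam pairs -/

section Gains

variable {nB nM K S : ℕ}

/-- The product of the projections of a beam pair on the array responses in direction `d`. -/
def pairResponse (N : ℕ) (aB : ℝ → Fin nB → ℂ) (aM : ℝ → Fin nM → ℂ)
    (F : Codebook nB K S) (W : Codebook nM K S) (s : Fin S) (kB kM : ℕ)
    (m : BeamPair K) (d : Direction N) : ℂ :=
  star (((dictionary N aM)ᴴ * W.mat s kM) d.2 m.2) * ((dictionary N aB)ᴴ * F.mat s kB) d.1 m.1

variable {N : ℕ} {aB : ℝ → Fin nB → ℂ} {aM : ℝ → Fin nM → ℂ}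
  {F : Codebook nB K S} {W : Codebook nM K S} {s : Fin S} {kB kM : ℕ}
  {m : BeamPair K} {d : Direction N}

/-- Expanding `(E_B + C_B G_B) ⊗ (E_M + C_M G_M)` gives the joint error plus `C_B C_M` times the
joint pattern. Only moduli agree, because the combiner enters the response conjugated. -/
lemma norm_jointError_add :
    ‖jointError N aB aM F W s kB kM m d + F.C s * W.C s * jointPattern N K s kB kM m d‖ =
      ‖pairResponse N aB aM F W s kB kM m d‖ := by
  rw [pairResponse, norm_mul, norm_star, ← norm_mul]
  congr 1
  simp only [jointError, jointPattern, errorMatrix, Matrix.add_apply, Matrix.sub_apply,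
    Matrix.kroneckerMap_apply, Matrix.transpose_apply, Matrix.smul_apply, smul_eq_mul]
  ring

lemma forwardGain_eq (h : jointPattern N K s kB kM m d = 1) :
    forwardGain N aB aM F W s kB kM m d =
      nB * nM * ‖pairResponse N aB aM F W s kB kM m d‖ ^ 2 := by
  have hs : Real.sqrt (nominalGain F W s) = Real.sqrt (nB * nM) * (F.C s * W.C s) := by
    have : nominalGain F W s = nB * nM * (F.C s * W.C s) ^ 2 := by
      rw [nominalGain]; ring
    rw [this, Real.sqrt_mul (by positivity),
      Real.sqrt_sq (mul_nonneg (F.C_nonneg s) (W.C_nonneg s))]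
  rw [forwardGain, hs, ← norm_jointError_add, h]
  have : ((Real.sqrt (nB * nM) * (F.C s * W.C s) : ℝ) : ℂ)
      + (Real.sqrt (nB * nM) : ℂ) * jointError N aB aM F W s kB kM m d
      = (Real.sqrt (nB * nM) : ℂ) *
        (jointError N aB aM F W s kB kM m d + F.C s * W.C s * 1) := by
    push_cast
    ring
  rw [this, norm_mul, mul_pow, Complex.norm_real, Real.norm_eq_abs, sq_abs,
    Real.sq_sqrt (by positivity)]

lemma backwardGain_eq (h : jointPattern N K s kB kM m d = 0) :
    backwardGain N aB aM F W s kB kM m d =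
      nB * nM * ‖pairResponse N aB aM F W s kB kM m d‖ ^ 2 := by
  rw [backwardGain, ← norm_jointError_add, h, mul_zero, add_zero]

/-- The weights with which the noise samples enter the measurement of the pair `m`. -/
def noiseWeight (W : Codebook nM K S) (s : Fin S) (kM : ℕ) (m : BeamPair K) :
    NoiseIndex S K nM → ℂ :=
  fun j => if j.1 = s ∧ j.2.1 = m.1 ∧ j.2.2.1 = m.2 then star (W.mat s kM j.2.2.2 m.2) else 0

/-- Stated for general `g` to serve both the noise term and the squared norm of the weights. -/
lemma sum_noiseWeight {M : Type*} [AddCommMonoid M] (g : ℂ → NoiseIndex S K nM → M)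
    (hg : ∀ j, g 0 j = 0) :
    ∑ j, g (noiseWeight W s kM m j) j =
      ∑ i, g (star (W.mat s kM i m.2)) (s, m.1, m.2, i) := by
  rw [Fintype.sum_prod_type, Finset.sum_eq_single s, Fintype.sum_prod_type,
    Finset.sum_eq_single m.1, Fintype.sum_prod_type, Finset.sum_eq_single m.2]
  · simp [noiseWeight]
  all_goals simp +contextual [noiseWeight, hg]

lemma sum_norm_sq_noiseWeight (hk : kM < K ^ (s : ℕ)) :
    ∑ j, ‖noiseWeight W s kM m j‖ ^ 2 = 1 := by
  rw [sum_noiseWeight (fun z _ => ‖z‖ ^ 2) (by simp)]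
  simpa only [norm_star] using W.unit_norm s kM m.2 hk

lemma noiseWeight_disjoint {m' : BeamPair K} (h : m ≠ m') (j : NoiseIndex S K nM) :
    noiseWeight W s kM m j = 0 ∨ noiseWeight W s kM m' j = 0 := by
  by_contra! hne
  simp only [noiseWeight, ne_eq, ite_eq_right_iff, Classical.not_imp] at hne
  exact h (Prod.ext (hne.1.1.2.1.symm.trans hne.2.1.2.1) (hne.1.1.2.2.symm.trans hne.2.1.2.2))

lemma received_eq (P : Fin S → ℝ) (ρ : ℝ) (α : ℂ) (noise : NoiseIndex S K nM → ℂ) :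
    received F W P (channel aB aM ρ α (gridAngle N d.1) (gridAngle N d.2)) noise s kB kM m =
      (Real.sqrt (P s) * Real.sqrt (nB * nM / ρ) * pairResponse N aB aM F W s kB kM m d) * α
        + ∑ j, noiseWeight W s kM m j * noise j := by
  rw [sum_noiseWeight (fun z j => z * noise j) (by simp), received]
  congr 1
  have h1 : ((W.mat s kM)ᴴ * channel aB aM ρ α (gridAngle N d.1) (gridAngle N d.2)
      * F.mat s kB) m.2 m.1 = Real.sqrt (nB * nM / ρ) * α *
        pairResponse N aB aM F W s kB kM m d := by
    rw [channel, pairResponse, Matrix.mul_smul, Matrix.smul_mul, Matrix.smul_apply, smul_eq_mul]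
    congr 1
    rw [Matrix.mul_vecMulVec, Matrix.vecMulVec_mul, Matrix.vecMulVec_apply]
    simp only [Matrix.mulVec, Matrix.vecMul, dotProduct, Matrix.mul_apply,
      Matrix.conjTranspose_apply, dictionary, Matrix.of_apply, star_sum, star_mul', star_star,
      Pi.star_apply]
    congr 1
    exact Finset.sum_congr rfl fun i _ => mul_comm _ _
  rw [h1]
  ring

end Gains

/-! ### The path of subsets that lead to a grid point -/

/-- The subset of level `s` that contains the grid point `u`. -/
def pathIndex (K S s u : ℕ) : ℕ := u / K ^ (S - s)

lemma pathIndex_succ {K S s : ℕ} (hs : s < S) (u : ℕ) :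
    pathIndex K S (s + 1) u = K * pathIndex K S s u + pathIndex K S (s + 1) u % K := by
  have : S - s = S - (s + 1) + 1 := by omega
  rw [pathIndex, pathIndex, this, pow_succ, ← Nat.div_div_eq_div_mul, Nat.div_add_mod]

lemma pathIndex_lt {K S s u : ℕ} (hK : 0 < K) (hs : s ≤ S) (hu : u < K ^ S) :
    pathIndex K S s u < K ^ s := by
  rw [pathIndex, Nat.div_lt_iff_lt_mul (by positivity), ← pow_add]
  rwa [Nat.add_sub_cancel' hs]

/-- The beam of the subset `pathIndex K S s u` whose sub-range contains `u`. -/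
def pathBeam {K : ℕ} (hK : 0 < K) (S s u : ℕ) : Fin K :=
  ⟨pathIndex K S (s + 1) u % K, Nat.mod_lt _ hK⟩

lemma inSubrange_pathIndex_iff {K S s u : ℕ} (hK : 0 < K) (hs : s < S) (m : Fin K) :
    InSubrange (K ^ S) K s (pathIndex K S s u) m u ↔ m = pathBeam hK S s u := by
  have hq : K ^ S / K ^ (s + 1) = K ^ (S - (s + 1)) := Nat.pow_div hs hK
  have hpos : 0 < K ^ (S - (s + 1)) := by positivity
  have h1 : InSubrange (K ^ S) K s (pathIndex K S s u) m u ↔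
      pathIndex K S (s + 1) u = K * pathIndex K S s u + m := by
    rw [InSubrange, hq, pathIndex, pathIndex, Nat.div_eq_iff hpos]
    constructor
    · rintro ⟨h1, h2⟩
      constructor
      · rw [mul_comm]; exact h1
      · rw [mul_add, mul_one] at h2
        rw [mul_comm]; omega
    · rintro ⟨h1, h2⟩
      rw [mul_comm] at h1 h2
      refine ⟨h1, ?_⟩
      rw [mul_add _ _ 1, mul_one]
      omega
  rw [h1, Fin.ext_iff]
  have h2 := pathIndex_succ (K := K) hs u
  simp only [pathBeam]
  omega

lemma jointPattern_pathIndex {K S : ℕ} (hK : 0 < K) (s : Fin S) (d : Direction (K ^ S))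
    (m : BeamPair K) :
    jointPattern (K ^ S) K s (pathIndex K S s d.1) (pathIndex K S s d.2) m d =
      if m = (pathBeam hK S s d.1, pathBeam hK S s d.2) then 1 else 0 := by
  simp only [jointPattern, Matrix.kroneckerMap_apply, Matrix.transpose_apply, patternMatrix,
    Matrix.of_apply, inSubrange_pathIndex_iff hK s.2, Prod.ext_iff]
  split_ifs <;> simp_all

/-- The path index consists of the leading `s` base-`K` digits of `u`, and each correct decision
appends the next digit. Correctness is required only for the true subsets, which induction shows to
be the ones in use. -/
lemma search_eq_pathIndex {nB nM K S : ℕ} (hK : 0 < K)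
    (sel : (BeamPair K → ℂ) → BeamPair K) (F : Codebook nB K S) (W : Codebook nM K S)
    (P : Fin S → ℝ) (H : Matrix (Fin nM) (Fin nB) ℂ) (noise : NoiseIndex S K nM → ℂ)
    (d : Direction (K ^ S))
    (h : ∀ s : Fin S, sel (received F W P H noise s (pathIndex K S s d.1) (pathIndex K S s d.2))
      = (pathBeam hK S s d.1, pathBeam hK S s d.2)) (i : Fin (S + 1)) :
    search sel F W P H noise i = (pathIndex K S i d.1, pathIndex K S i d.2) := by
  induction i using Fin.induction with
  | zero => simp [search, pathIndex, Nat.div_eq_of_lt]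
  | succ s ih =>
    have hstep : search sel F W P H noise s.succ =
        (K * (search sel F W P H noise s.castSucc).1
            + (sel (received F W P H noise s (search sel F W P H noise s.castSucc).1
              (search sel F W P H noise s.castSucc).2)).1,
          K * (search sel F W P H noise s.castSucc).2
            + (sel (received F W P H noise s (search sel F W P H noise s.castSucc).1
              (search sel F W P H noise s.castSucc).2)).2) := by
      simp only [search, Fin.induction_succ]
    rw [hstep, ih]
    simp only [Fin.val_castSucc, h s, Fin.val_succ, pathBeam]
    rw [← pathIndex_succ s.2, ← pathIndex_succ s.2]

/-! ### The summand of the bound -/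

lemma stageTerm_eq (β : ℝ≥0∞) (x : ℝ) :
    stageTerm β x = 1 - (1 - (β⁻¹).toReal) * x / Real.sqrt (((1 - (β⁻¹).toReal) * x) ^ 2
      + (8 * (1 + (β⁻¹).toReal) * x + 16)) := by
  have : ((1 - (β⁻¹).toReal) * x) ^ 2 + (8 * (1 + (β⁻¹).toReal) * x + 16)
      = 4 ^ 2 * (1 + 1 / 2 * (1 + (β⁻¹).toReal) * x
        + 1 / 16 * x ^ 2 * (1 - (β⁻¹).toReal) ^ 2) := by ring
  rw [stageTerm, this, Real.sqrt_mul (by norm_num), Real.sqrt_sq (by norm_num)]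

lemma stageTerm_nonneg (β : ℝ≥0∞) {x : ℝ} (hx : 0 ≤ x) : 0 ≤ stageTerm β x := by
  have hr : 0 ≤ (β⁻¹).toReal := ENNReal.toReal_nonneg
  rw [stageTerm_eq, sub_nonneg]
  refine div_le_one_of_le₀ (Real.le_sqrt_of_sq_le ?_) (Real.sqrt_nonneg _)
  have : 0 ≤ 8 * (1 + (β⁻¹).toReal) * x + 16 := by positivity
  linarith

lemma one_le_stageTerm {β : ℝ≥0∞} {x : ℝ} (h : (1 - (β⁻¹).toReal) * x ≤ 0) :
    1 ≤ stageTerm β x := by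
  rw [stageTerm_eq]
  have := div_nonpos_of_nonpos_of_nonneg h (Real.sqrt_nonneg
    (((1 - (β⁻¹).toReal) * x) ^ 2 + (8 * (1 + (β⁻¹).toReal) * x + 16)))
  linarith

/-- For `n ≥ 0` the quotient is an increasing function of `n² / q`. -/
lemma div_sqrt_sq_add_le {n₀ n q₀ q : ℝ} (hn₀ : 0 ≤ n₀) (hn : 0 ≤ n) (hq₀ : 0 < q₀) (hq : 0 < q)
    (h : n₀ ^ 2 * q ≤ n ^ 2 * q₀) :
    n₀ / Real.sqrt (n₀ ^ 2 + q₀) ≤ n / Real.sqrt (n ^ 2 + q) := by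
  rw [div_le_div_iff₀ (by positivity) (by positivity)]
  refine (sq_le_sq₀ (by positivity) (by positivity)).1 ?_
  rw [mul_pow, mul_pow, Real.sq_sqrt (by positivity), Real.sq_sqrt (by positivity)]
  linarith

/-- The summand of the bound dominates twice the pairwise error probability, for smaller signal
strength `x₀`, larger leakage ratio and larger noise power. -/
lemma pairwise_le_stageTerm {β : ℝ≥0∞} {x₀ x y κ : ℝ} (hx₀ : 0 ≤ x₀) (hx : x₀ ≤ x) (hy : 0 ≤ y)
    (hr1 : (β⁻¹).toReal ≤ 1) (hyx : y ≤ (β⁻¹).toReal * x) (hκ : 0 < κ) (hκ2 : κ ≤ 2) :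
    1 - (x - y) / Real.sqrt ((x - y) ^ 2 + (4 * κ * (x + y) + 4 * κ ^ 2)) ≤ stageTerm β x₀ := by
  rw [stageTerm_eq]
  set r := (β⁻¹).toReal
  have hr : 0 ≤ r := ENNReal.toReal_nonneg
  have hx' : 0 ≤ x := hx₀.trans hx
  have hn₀ : 0 ≤ (1 - r) * x₀ := mul_nonneg (by linarith) hx₀
  have hle : (1 - r) * x₀ ≤ x - y := by
    have := mul_le_mul_of_nonneg_left hx (by linarith : 0 ≤ 1 - r)
    linarith
  have hn : 0 ≤ x - y := hn₀.trans hle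
  refine sub_le_sub_left (div_sqrt_sq_add_le hn₀ hn (by positivity) (by positivity) ?_) 1
  have hq : 4 * κ * (x + y) + 4 * κ ^ 2 ≤ 8 * (x + y) + 16 := by
    have h1 : κ * (x + y) ≤ 2 * (x + y) := mul_le_mul_of_nonneg_right hκ2 (by linarith)
    nlinarith
  have h16 : ((1 - r) * x₀) ^ 2 ≤ (x - y) ^ 2 := pow_le_pow_left₀ hn₀ hle 2
  -- The second factors compare because `(x - y)(1 + r) - (1 - r)(x + y) = 2 (r x - y)`.
  have h8 : ((1 - r) * x₀) * ((1 - r) * (x + y)) ≤ (x - y) * ((x - y) * (1 + r)) := by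
    refine mul_le_mul hle (by linarith) (mul_nonneg (by linarith) (by linarith)) hn
  calc ((1 - r) * x₀) ^ 2 * (4 * κ * (x + y) + 4 * κ ^ 2)
      ≤ ((1 - r) * x₀) ^ 2 * (8 * (x + y) + 16) := mul_le_mul_of_nonneg_left hq (sq_nonneg _)
    _ = 8 * x₀ * (((1 - r) * x₀) * ((1 - r) * (x + y))) + 16 * ((1 - r) * x₀) ^ 2 := by ring
    _ ≤ 8 * x₀ * ((x - y) * ((x - y) * (1 + r))) + 16 * (x - y) ^ 2 := by gcongr
    _ = (x - y) ^ 2 * (8 * (1 + r) * x₀ + 16) := by ring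

/-! ### Worst-case gains and ratios -/

section Worst

variable {nB nM K S N : ℕ} {aB : ℝ → Fin nB → ℂ} {aM : ℝ → Fin nM → ℂ}
  {F : Codebook nB K S} {W : Codebook nM K S} {D : Set (Direction N)} {s : Fin S} {kB kM : ℕ}
  {m m' : BeamPair K} {d : Direction N}

lemma forwardGain_nonneg : 0 ≤ forwardGain N aB aM F W s kB kM m d := sq_nonneg _

lemma backwardGain_nonneg : 0 ≤ backwardGain N aB aM F W s kB kM m d := by
  rw [backwardGain]
  positivity

lemma worstForwardGain_nonneg : 0 ≤ worstForwardGain N aB aM F W D s := by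
  refine Real.sInf_nonneg ?_
  rintro _ ⟨_, _, _, _, _, _, _, _, rfl⟩
  exact forwardGain_nonneg

lemma worstForwardGain_le (hB : kB < K ^ (s : ℕ)) (hM : kM < K ^ (s : ℕ)) (hd : d ∈ D)
    (h : jointPattern N K s kB kM m d = 1) :
    worstForwardGain N aB aM F W D s ≤ forwardGain N aB aM F W s kB kM m d := by
  refine csInf_le ⟨0, ?_⟩ ⟨kB, hB, kM, hM, d, hd, m, h, rfl⟩
  rintro _ ⟨_, _, _, _, _, _, _, _, rfl⟩
  exact forwardGain_nonneg

lemma worstRatio_le (hB : kB < K ^ (s : ℕ)) (hM : kM < K ^ (s : ℕ)) (hd : d ∈ D)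
    (h : jointPattern N K s kB kM m d = 1) (h' : jointPattern N K s kB kM m' d = 0) :
    worstRatio N aB aM F W D s ≤ ENNReal.ofReal (forwardGain N aB aM F W s kB kM m d) /
      ENNReal.ofReal (backwardGain N aB aM F W s kB kM m' d) :=
  sInf_le ⟨kB, hB, kM, hM, d, hd, m, m', h, h', rfl⟩

/-- The worst ratio is attained, so it vanishes only if a forward gain does. -/
lemma worstForwardGain_eq_zero_of_worstRatio_eq_zero
    (h0 : worstRatio N aB aM F W D s = 0) : worstForwardGain N aB aM F W D s = 0 := by
  set T := {r | ∃ kB < K ^ (s : ℕ), ∃ kM < K ^ (s : ℕ), ∃ d ∈ D, ∃ m m' : BeamPair K,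
    jointPattern N K s kB kM m d = 1 ∧ jointPattern N K s kB kM m' d = 0 ∧
    r = ENNReal.ofReal (forwardGain N aB aM F W s kB kM m d) /
      ENNReal.ofReal (backwardGain N aB aM F W s kB kM m' d)} with hT
  have hfin : T.Finite := by
    refine Set.Finite.subset (Set.finite_range
      (fun q : Fin (K ^ (s : ℕ)) × Fin (K ^ (s : ℕ)) × Direction N × BeamPair K × BeamPair K =>
        ENNReal.ofReal (forwardGain N aB aM F W s q.1 q.2.1 q.2.2.2.1 q.2.2.1) /
        ENNReal.ofReal (backwardGain N aB aM F W s q.1 q.2.1 q.2.2.2.2 q.2.2.1))) ?_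
    rintro _ ⟨kB, hB, kM, hM, d, _, m, m', _, _, rfl⟩
    exact ⟨(⟨kB, hB⟩, ⟨kM, hM⟩, d, m, m'), rfl⟩
  have hne : T.Nonempty := by
    by_contra hne
    rw [Set.not_nonempty_iff_eq_empty] at hne
    rw [worstRatio, ← hT, hne, sInf_empty] at h0
    exact ENNReal.top_ne_zero h0
  obtain ⟨kB, hB, kM, hM, d, hd, m, m', hm, _, hr⟩ := hne.csInf_mem hfin
  have hr0 : ENNReal.ofReal (forwardGain N aB aM F W s kB kM m d) = 0 := by
    have : sInf T = 0 := h0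
    rw [this, eq_comm, ENNReal.div_eq_zero_iff] at hr
    exact hr.resolve_right ENNReal.ofReal_ne_top
  refine le_antisymm ?_ worstForwardGain_nonneg
  exact (worstForwardGain_le hB hM hd hm).trans (ENNReal.ofReal_eq_zero.1 hr0)

lemma backwardGain_le (h0 : worstRatio N aB aM F W D s ≠ 0)
    (hB : kB < K ^ (s : ℕ)) (hM : kM < K ^ (s : ℕ)) (hd : d ∈ D)
    (h : jointPattern N K s kB kM m d = 1) (h' : jointPattern N K s kB kM m' d = 0) :
    backwardGain N aB aM F W s kB kM m' d ≤
      ((worstRatio N aB aM F W D s)⁻¹).toReal * forwardGain N aB aM F W s kB kM m d := by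
  have hle := ENNReal.inv_le_inv.2
    (worstRatio_le (aB := aB) (aM := aM) (F := F) (W := W) hB hM hd h h')
  -- Inverting the quotient needs a nonzero forward gain; a zero one would force the worst ratio to
  -- be `0`.
  rw [ENNReal.inv_div (Or.inl ENNReal.ofReal_ne_top) (Or.inr (by
    intro hz
    refine h0 (le_antisymm ((worstRatio_le hB hM hd h h').trans ?_) zero_le)
    rw [hz, ENNReal.zero_div]))] at hle
  have htop : (worstRatio N aB aM F W D s)⁻¹ ≠ ⊤ := ENNReal.inv_ne_top.2 h0
  have h2 : ENNReal.ofReal (backwardGain N aB aM F W s kB kM m' d) ≤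
      (worstRatio N aB aM F W D s)⁻¹ * ENNReal.ofReal (forwardGain N aB aM F W s kB kM m d) := by
    refine (ENNReal.div_le_iff_le_mul (Or.inr htop) (Or.inl ENNReal.ofReal_ne_top)).1 hle
  have h3 := ENNReal.toReal_mono (ENNReal.mul_ne_top htop ENNReal.ofReal_ne_top) h2
  rwa [ENNReal.toReal_mul, ENNReal.toReal_ofReal backwardGain_nonneg,
    ENNReal.toReal_ofReal forwardGain_nonneg] at h3

end Worst

/-! ### The error probability -/

section ErrorProbability

variable {Ω : Type*} [MeasurableSpace Ω] {μ : Measure Ω} [IsProbabilityMeasure μ]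
  {nB nM K S : ℕ} {aB : ℝ → Fin nB → ℂ} {aM : ℝ → Fin nM → ℂ}
  {F : Codebook nB K S} {W : Codebook nM K S}
  {P : Fin S → ℝ} {ρ : ℝ} {PR ν : ℝ≥0} {σ : ℝ}
  {α : Ω → ℂ} {noise : NoiseIndex S K nM → Ω → ℂ}

/-- Signal powers are measured in units of `σ²`, so the noise convention survives only in the ratio
`ν / σ ^ 2`. -/
lemma measure_received_le {N : ℕ} (hP : ∀ s, 0 ≤ P s) (hρ : 0 < ρ) (hσ : 0 < σ) (hν0 : ν ≠ 0)
    (hα : HasLaw α (complexGaussian PR) μ) (hnoise : ∀ i, HasLaw (noise i) (complexGaussian ν) μ)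
    (hindep : iIndepFun noise μ) (hαnoise : IndepFun α (fun ω i => noise i ω) μ)
    (d : Direction N) {s : Fin S} {kB kM : ℕ} (hM : kM < K ^ (s : ℕ))
    {m m' : BeamPair K} (h : jointPattern N K s kB kM m d = 1)
    (h' : jointPattern N K s kB kM m' d = 0) {x y : ℝ}
    (hx : x = P s * forwardGain N aB aM F W s kB kM m d * (PR / (ρ * σ ^ 2)))
    (hy : y = P s * backwardGain N aB aM F W s kB kM m' d * (PR / (ρ * σ ^ 2))) :
    μ.real {ω | ‖received F W P (channel aB aM ρ (α ω) (gridAngle N d.1) (gridAngle N d.2))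
        (fun i => noise i ω) s kB kM m‖ ≤
      ‖received F W P (channel aB aM ρ (α ω) (gridAngle N d.1) (gridAngle N d.2))
        (fun i => noise i ω) s kB kM m'‖} =
    (1 - (x - y) / Real.sqrt ((x - y) ^ 2
      + (4 * (ν / σ ^ 2) * (x + y) + 4 * (ν / σ ^ 2) ^ 2))) / 2 := by
  have hmm : m ≠ m' := by
    rintro rfl
    rw [h] at h'
    exact one_ne_zero h'
  have hamp : ∀ z : ℂ, (PR : ℝ) * ‖(Real.sqrt (P s) : ℂ) * Real.sqrt (nB * nM / ρ) * z‖ ^ 2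
      = σ ^ 2 * (P s * (nB * nM * ‖z‖ ^ 2) * (PR / (ρ * σ ^ 2))) := by
    intro z
    rw [norm_mul, norm_mul, mul_pow, mul_pow, Complex.norm_real, Complex.norm_real,
      Real.norm_eq_abs, Real.norm_eq_abs, sq_abs, sq_abs, Real.sq_sqrt (hP s),
      Real.sq_sqrt (by positivity)]
    field_simp
  simp_rw [received_eq]
  rw [measure_norm_le_norm_of_observations hν0 hα hnoise hindep hαnoise _ _ _ _
    (sum_norm_sq_noiseWeight hM) (sum_norm_sq_noiseWeight hM) (noiseWeight_disjoint hmm),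
    hamp, hamp, ← forwardGain_eq h, ← backwardGain_eq h', ← hx, ← hy]
  have hs : (σ ^ 2 * x - σ ^ 2 * y) ^ 2 + 4 * ν * (σ ^ 2 * x + σ ^ 2 * y) + 4 * (ν : ℝ) ^ 2
      = (σ ^ 2) ^ 2 * ((x - y) ^ 2
        + (4 * (ν / σ ^ 2) * (x + y) + 4 * (ν / σ ^ 2) ^ 2)) := by
    field_simp
    ring
  rw [hs, Real.sqrt_mul (by positivity), Real.sqrt_sq (by positivity), ← mul_sub,
    mul_div_mul_left _ _ (by positivity)]

lemma errorProbability_le (hK : 2 ≤ K) {sel : (BeamPair K → ℂ) → BeamPair K}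
    (hsel : IsArgmaxRule sel)
    (hP : ∀ s, 0 ≤ P s) (hρ : 0 < ρ) (hσ : 0 < σ) (hν0 : ν ≠ 0) (hν : (ν : ℝ) ≤ 2 * σ ^ 2)
    (hα : HasLaw α (complexGaussian PR) μ) (hnoise : ∀ i, HasLaw (noise i) (complexGaussian ν) μ)
    (hindep : iIndepFun noise μ) (hαnoise : IndepFun α (fun ω i => noise i ω) μ)
    (d : Direction (K ^ S)) {D : Set (Direction (K ^ S))} (hd : d ∈ D) :
    μ.real {ω | estimate (K ^ S) sel F W P (channel aB aM ρ (α ω) (gridAngle (K ^ S) d.1)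
        (gridAngle (K ^ S) d.2)) (fun i => noise i ω) ≠
          (gridAngle (K ^ S) d.1, gridAngle (K ^ S) d.2)} ≤
      errorBound K P (PR / (ρ * σ ^ 2)) (worstRatio (K ^ S) aB aM F W D)
        (worstForwardGain (K ^ S) aB aM F W D) := by
  have hK0 : 0 < K := by omega
  have hK2 : (4 : ℝ) ≤ (K : ℝ) ^ 2 := by
    have : (2 : ℝ) ≤ K := by exact_mod_cast hK
    nlinarith
  set γ := (PR : ℝ) / (ρ * σ ^ 2) with hγ
  have hγ0 : 0 ≤ γ := by positivity
  set β := worstRatio (K ^ S) aB aM F W D with hβ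
  set G := worstForwardGain (K ^ S) aB aM F W D with hG
  have hG0 : ∀ s, 0 ≤ G s := fun s => worstForwardGain_nonneg
  have hx0 : ∀ s, 0 ≤ P s * G s * γ := fun s => mul_nonneg (mul_nonneg (hP s) (hG0 s)) hγ0
  -- The prefactor is at least `3 / 2` and all summands are nonnegative, so one summand of size `1`
  -- already exceeds any probability. Otherwise every `β s` is nonzero and `1 / β s ≤ 1`; this also
  -- excludes the value `β = 0`, where `(β⁻¹).toReal` is `0` by default.
  by_cases htriv : ∃ s, 1 ≤ stageTerm (β s) (P s * G s * γ)
  · obtain ⟨s, hs⟩ := htriv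
    refine measureReal_le_one.trans ?_
    have hsum : 1 ≤ ∑ s, stageTerm (β s) (P s * G s * γ) :=
      hs.trans (Finset.single_le_sum (f := fun s => stageTerm (β s) (P s * G s * γ))
        (fun i _ => stageTerm_nonneg _ (hx0 i)) (Finset.mem_univ s))
    rw [errorBound]
    nlinarith
  push Not at htriv
  have hβ0 : ∀ s, β s ≠ 0 := by
    intro s h0
    refine absurd (one_le_stageTerm ?_) (htriv s).not_ge
    rw [hG, worstForwardGain_eq_zero_of_worstRatio_eq_zero h0]
    simp
  have hr1 : ∀ s, ((β s)⁻¹).toReal ≤ 1 := by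
    intro s
    by_contra! hlt
    exact absurd (one_le_stageTerm
      (mul_nonpos_of_nonpos_of_nonneg (by linarith) (hx0 s))) (htriv s).not_ge
  set Y : Fin S → BeamPair K → Ω → ℂ := fun s m ω =>
    received F W P (channel aB aM ρ (α ω) (gridAngle (K ^ S) d.1) (gridAngle (K ^ S) d.2))
      (fun i => noise i ω) s (pathIndex K S s d.1) (pathIndex K S s d.2) m with hY
  set b : Fin S → BeamPair K := fun s => (pathBeam hK0 S s d.1, pathBeam hK0 S s d.2) with hb
  -- The non-strict inequality absorbs every tie-breaking rule, and monotonicity of the outer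
  -- measure requires no measurability of `sel`.
  have hsub : {ω | estimate (K ^ S) sel F W P (channel aB aM ρ (α ω) (gridAngle (K ^ S) d.1)
        (gridAngle (K ^ S) d.2)) (fun i => noise i ω) ≠
          (gridAngle (K ^ S) d.1, gridAngle (K ^ S) d.2)} ⊆
      ⋃ s ∈ (Finset.univ : Finset (Fin S)), ⋃ m ∈ Finset.univ.erase (b s),
        {ω | ‖Y s (b s) ω‖ ≤ ‖Y s m ω‖} := by
    intro ω hω
    by_contra hnot
    simp only [Set.mem_iUnion, Finset.mem_univ, Finset.mem_erase, and_true, not_exists,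
      Set.mem_ofPred_eq] at hnot
    refine hω ?_
    have hcorrect : ∀ s : Fin S, sel (fun m => Y s m ω) = b s := by
      intro s
      by_contra hne
      refine hnot s trivial _ hne ?_
      exact (sq_le_sq₀ (norm_nonneg _) (norm_nonneg _)).1 (hsel (fun m => Y s m ω) (b s))
    rw [estimate, search_eq_pathIndex hK0 sel F W P _ _ d hcorrect]
    simp [pathIndex]
  have hpair : ∀ s, ∀ m ∈ Finset.univ.erase (b s),
      μ.real {ω | ‖Y s (b s) ω‖ ≤ ‖Y s m ω‖} ≤ stageTerm (β s) (P s * G s * γ) / 2 := by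
    intro s m hm
    have hmb : m ≠ b s := Finset.ne_of_mem_erase hm
    have hB := pathIndex_lt hK0 s.2.le d.1.2
    have hM := pathIndex_lt hK0 s.2.le d.2.2
    have h1 : jointPattern (K ^ S) K s (pathIndex K S s d.1) (pathIndex K S s d.2) (b s) d = 1 := by
      rw [jointPattern_pathIndex hK0, if_pos rfl]
    have h0 : jointPattern (K ^ S) K s (pathIndex K S s d.1) (pathIndex K S s d.2) m d = 0 := by
      rw [jointPattern_pathIndex hK0, if_neg hmb]
    rw [hY, measure_received_le hP hρ hσ hν0 hα hnoise hindep hαnoise d hM h1 h0 rfl rfl]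
    refine div_le_div_of_nonneg_right (pairwise_le_stageTerm (hx0 s) ?_ ?_ (hr1 s) ?_ ?_ ?_)
      two_pos.le
    · exact mul_le_mul_of_nonneg_right (mul_le_mul_of_nonneg_left
        (worstForwardGain_le hB hM hd h1) (hP s)) hγ0
    · exact mul_nonneg (mul_nonneg (hP s) backwardGain_nonneg) hγ0
    · have := mul_le_mul_of_nonneg_right (mul_le_mul_of_nonneg_left
        (backwardGain_le (hβ0 s) hB hM hd h1 h0) (hP s)) hγ0
      refine this.trans_eq ?_
      ring
    · positivity
    · rwa [div_le_iff₀ (by positivity)]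
  calc _ ≤ μ.real (⋃ s ∈ (Finset.univ : Finset (Fin S)), ⋃ m ∈ Finset.univ.erase (b s),
        {ω | ‖Y s (b s) ω‖ ≤ ‖Y s m ω‖}) := measureReal_mono hsub (measure_ne_top _ _)
    _ ≤ ∑ s, μ.real (⋃ m ∈ Finset.univ.erase (b s), {ω | ‖Y s (b s) ω‖ ≤ ‖Y s m ω‖}) :=
        measureReal_biUnion_finset_le _ _
    _ ≤ ∑ s, ∑ m ∈ Finset.univ.erase (b s), μ.real {ω | ‖Y s (b s) ω‖ ≤ ‖Y s m ω‖} :=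
        Finset.sum_le_sum fun s _ => measureReal_biUnion_finset_le _ _
    _ ≤ ∑ s, ∑ m ∈ Finset.univ.erase (b s), stageTerm (β s) (P s * G s * γ) / 2 :=
        Finset.sum_le_sum fun s _ => Finset.sum_le_sum (hpair s)
    _ = errorBound K P γ β G := by
      have hcard : ∀ s, ((Finset.univ.erase (b s)).card : ℝ) = (K : ℝ) ^ 2 - 1 := by
        intro s
        rw [Finset.card_erase_of_mem (Finset.mem_univ _), Finset.card_univ, Fintype.card_prod,
          Fintype.card_fin, Nat.cast_sub (by nlinarith)]
        push_cast
        ring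
      simp_rw [Finset.sum_const, nsmul_eq_mul, hcard, errorBound, Finset.mul_sum]
      exact Finset.sum_congr rfl fun s _ => by ring

end ErrorProbability

end MmWave

end

theorem theorem1 {Ω : Type*} [MeasurableSpace Ω] (μ : MeasureTheory.Measure Ω)
    [MeasureTheory.IsProbabilityMeasure μ]
    (nB nM K S N : ℕ) (hK : 2 ≤ K) (hN : N = K ^ S)
    -- antenna arrays, codebooks, selection rule
    (aB : ℝ → Fin nB → ℂ) (aM : ℝ → Fin nM → ℂ)
    (F : MmWave.Codebook nB K S) (W : MmWave.Codebook nM K S)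
    (sel : (MmWave.BeamPair K → ℂ) → MmWave.BeamPair K) (hsel : MmWave.IsArgmaxRule sel)
    -- training powers, path loss, mean path power, noise level
    (P : Fin S → ℝ) (hP : ∀ s, 0 ≤ P s) (ρ : ℝ) (hρ : 0 < ρ) (PR : NNReal)
    (σ : ℝ) (hσ : 0 < σ)
    -- mean noise power: both conventions for a complex Gaussian of variance `σ²`
    (ν : NNReal) (hν : (ν : ℝ) = σ ^ 2 ∨ (ν : ℝ) = 2 * σ ^ 2)
    -- path gain and noise
    (α : Ω → ℂ) (noise : MmWave.NoiseIndex S K nM → Ω → ℂ)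
    (hα : ProbabilityTheory.HasLaw α (MmWave.complexGaussian PR) μ)
    (hnoise : ∀ i, ProbabilityTheory.HasLaw (noise i) (MmWave.complexGaussian ν) μ)
    (hindep : ProbabilityTheory.iIndepFun noise μ)
    (hαnoise : ProbabilityTheory.IndepFun α (fun ω i => noise i ω) μ)
    -- the true direction
    (d : MmWave.Direction N) :
    let φ := MmWave.gridAngle N d.1
    let θ := MmWave.gridAngle N d.2
    let γ := (PR : ℝ) / (ρ * σ ^ 2)
    let p := μ.real {ω | MmWave.estimate N sel F W P (MmWave.channel aB aM ρ (α ω) φ θ)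
      (fun i => noise i ω) ≠ (φ, θ)}
    p ≤ MmWave.errorBound K P γ (MmWave.worstRatio N aB aM F W Set.univ)
        (MmWave.worstForwardGain N aB aM F W Set.univ) ∧
      p ≤ MmWave.errorBound K P γ (MmWave.worstRatio N aB aM F W {d})
        (MmWave.worstForwardGain N aB aM F W {d}) := by
  subst hN
  have hν0 : ν ≠ 0 := by
    rintro rfl
    have : 0 < σ ^ 2 := by positivity
    rcases hν with h | h <;> simp only [NNReal.coe_zero] at h <;> linarith
  have hν2 : (ν : ℝ) ≤ 2 * σ ^ 2 := by
    have : 0 < σ ^ 2 := by positivity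
    rcases hν with h | h <;> linarith
  -- Both cases are instances of one bound, which requires only that the minima range over a set
  -- containing the true direction.
  exact ⟨MmWave.errorProbability_le hK hsel hP hρ hσ hν0 hν2 hα hnoise hindep hαnoise d
      (Set.mem_univ d),
    MmWave.errorProbability_le hK hsel hP hρ hσ hν0 hν2 hα hnoise hindep hαnoise d
      (Set.mem_singleton d)⟩
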